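/- Let $\Gamma$ be a countable discrete group with neutral element $e$, equipped with a left-invariant proper metric inducing the discrete topology; write $B(e,r)$ for the open ball of radius $r$ around $e$. Let $\mathcal A$ be a finite alphabet with the discrete topology, and let $\mathcal A^\Gamma$ carry the product topology. A patch is a map $P:M\to\mathcal A$ with $M=\operatorname{supp}(P)\subseteq\Gamma$, and $\Gamma$ acts on patches by $(\gamma P)(x)=P(\gamma^{-1}x)$. For a finite set $M\subseteq \Gamma$ and $\omega\in\mathcal A^\Gamma$, let $W(\omega)_M$ be the set of patches $P$ with support $M$ such that $\gamma P=\omega|_{\gamma M}$ for some $\gamma\in\Gamma$. *Substitution maps.* Let $S_0:\mathcal A\to\mathcal A^F$ with $F\subseteq\Gamma$ finite, and let $D:\Gamma\to\Gamma$ be a group homomorphism with $\Gamma=\bigsqcup_{\gamma\in\Gamma}D(\gamma)F$. For $M\subseteq\Gamma$ put $F(0,M)=M$ and $F(n+1,M)=\bigcup_{\eta\in F(n,M)}D(\eta)F$. A substitution map $S$ with respect to $S_0$ is a map from patches to patches such that (a) $S(P_a)=S_0(a)$ for each $a\in\mathcal A$, where $P_a$ is the patch with support $\{e\}$ and $P_a(e)=a$;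 (b) $S(\gamma P)=D(\gamma)S(P)$ for all $\gamma\in\Gamma$ and all patches $P$; (c) for all patches $P$, all finite $M\subseteq\operatorname{supp}(P)$ and all $n\ge 0$, $F(n,M)$ is the support of $S^n(P|_M)$ and $S^n(P)|_{F(n,M)}=S^n(P|_M)$. Then $S$ maps $\mathcal A^\Gamma$ to itself. *Convenient testing domains.* A finite set $T\subseteq\Gamma$ is a convenient testing domain of $S$ if (a) for every $r>0$ there is $n_r\in\mathbb N$ such that for all $n\ge n_r$ and $x\in\Gamma$ there is $\gamma(n,x)\in\Gamma$ with $xB(e,r)\subseteq F(n,\gamma(n,x)T)$, where one can choose $\gamma(n,e)=e$; and (b) for every $x\in\Gamma$ there is $\gamma(x)\in\Gamma$ with $xT\subseteq F(1,\gamma(x)T)$, where one can choose $\gamma(e)=e$. *Schrödinger operators of finite range.* Such an operator is a family $H=(H_\omega)_{\omega\in\mathcal A^\Gamma}$ of bounded operators on $\ell^2(\Gamma)$ given by $$(H_\omega\psi)(\gamma)=\sum_{\eta\in B}t_\eta(\gamma^{-1}\omega)\,\psi(\gamma\eta),$$ where $B=B^{-1}\subseteq\Gamma$ is finite and the functions $t_\eta:\mathcal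 A^\Gamma\to\mathbb C$ ($\eta\in B$) are continuous and satisfy $t_\eta(\omega)=\overline{t_{\eta^{-1}}(\eta^{-1}\omega)}$. Every $H_\omega$ is then self-adjoint, and $\sigma(H_\omega)\subseteq\mathbb R$ denotes its spectrum. **Statement.** Let $S$ be a substitution map with a convenient testing domain $T$, and let $\omega_0\in\mathcal A^\Gamma$. Call an integer $\ell_0\ge1$ an *eventual period* if there is $N_0$ with $W(S^{n}(\omega_0))_T=W(S^{n+\ell_0}(\omega_0))_T$ for all $n\ge N_0$. Then an eventual period exists, and for every eventual period $\ell_0$ and every finite-range Schrödinger operator $H$ there exist non-empty compact sets $\Sigma_0,\dots,\Sigma_{\ell_0-1}\subseteq\mathbb R$ such that $$\lim_{n\to\infty}\sigma\bigl(H_{S^{n\ell_0+j}(\omega_0)}\bigr)=\Sigma_j\qquad\text{for all }0\le j\le\ell_0-1$$ in the Hausdorff metric on non-empty compact subsets of $\mathbb R$. -/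

import Mathlib

open Filter Topology Metric TopologicalSpace
open scoped Pointwise ENNReal

/-! ### Patches and configurations -/

/-- A patch `P : M → A` on a subset `M ⊆ Γ`, encoded as a partial function:
`P x = some a` if `x ∈ M` carries the letter `a`, and `P x = none` if `x ∉ M`. -/
abbrev Patch (Γ A : Type*) := Γ → Option A

namespace Patch

variable {Γ A : Type*}

/-- The support of a patch. -/
def supp (P : Patch Γ A) : Set Γ := {x | (P x).isSome}

/-- The restriction `P|_M` (its support is `M ∩ supp P`). -/
noncomputable def restrict (P : Patch Γ A) (M : Set Γ) : Patch Γ A :=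
  fun x => open Classical in if x ∈ M then P x else none

/-- A configuration `ω ∈ A^Γ` seen as a patch with full support. -/
def ofConfig (ω : Γ → A) : Patch Γ A := fun x => some (ω x)

/-- The patch with support `M` given by a function `M → A`. -/
noncomputable def ofFun (M : Finset Γ) (p : M → A) : Patch Γ A :=
  fun x => open Classical in if h : x ∈ M then some (p ⟨x, h⟩) else none

variable [Group Γ]

/-- The translation action `(γP)(x) = P(γ⁻¹x)`. -/
def translate (γ : Γ) (P : Patch Γ A) : Patch Γ A := fun x => P (γ⁻¹ * x)

/-- The single-letter patch `P_a : {e} → A`, `P_a(e) = a`. -/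
noncomputable def single (a : A) : Patch Γ A :=
  fun x => open Classical in if x = 1 then some a else none

/-- `P ≺ Q`: some translate of `P` occurs in `Q`. -/
def IsSubpatch (P Q : Patch Γ A) : Prop :=
  ∃ γ : Γ, γ • P.supp ⊆ Q.supp ∧ translate γ P = Q.restrict (γ • P.supp)

/-- The dictionary `W(ω)_M`: all patches with support `M` that occur in `ω`. -/
def dictionary (ω : Γ → A) (M : Finset Γ) : Set (Patch Γ A) :=
  {P | P.supp = (M : Set Γ) ∧ P.IsSubpatch (ofConfig ω)}

end Patch

/-! ### Substitution maps -/

/-- The sets `F(n, M)`: `F(0, M) = M` and `F(n + 1, M) = ⋃_{η ∈ F(n, M)} D(η)F`. -/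
def iteratedSupport {Γ : Type*} [Group Γ] (F : Finset Γ) (D : Γ →* Γ) : ℕ → Set Γ → Set Γ
  | 0, M => M
  | n + 1, M => ⋃ η ∈ iteratedSupport F D n M, D η • (F : Set Γ)

/-- A substitution map `S` on patches over `Γ` with letters in `A`, together with its substitution
rule `S₀ : A → A^F` and its homomorphism `D`. -/
structure SubstitutionMap (Γ A : Type*) [Group Γ] where
  /-- the support of the substitution rule -/
  F : Finset Γ
  /-- the substitution rule `S₀` -/
  rule : A → F → A
  /-- the dilating homomorphism -/
  D : Γ →* Γ
  /-- `Γ` is the disjoint union of the sets `D(η)F`, `η ∈ Γ` -/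
  tiling : ∀ γ : Γ, ∃! p : Γ × Γ, p.2 ∈ F ∧ D p.1 * p.2 = γ
  /-- the map `S` on patches -/
  toFun : Patch Γ A → Patch Γ A
  map_single : ∀ a : A, toFun (Patch.single a) = Patch.ofFun F (rule a)
  map_translate : ∀ (γ : Γ) (P : Patch Γ A),
    toFun (Patch.translate γ P) = Patch.translate (D γ) (toFun P)
  /-- `F(n, M)` is the support of `S^n(P|_M)`, for finite `M ⊆ supp P` -/
  supp_iterate : ∀ (P : Patch Γ A) (M : Set Γ), M.Finite → M ⊆ P.supp → ∀ n : ℕ,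
    (toFun^[n] (P.restrict M)).supp = iteratedSupport F D n M
  /-- `S^n(P)|_{F(n, M)} = S^n(P|_M)`, for finite `M ⊆ supp P` -/
  restrict_iterate : ∀ (P : Patch Γ A) (M : Set Γ), M.Finite → M ⊆ P.supp → ∀ n : ℕ,
    (toFun^[n] P).restrict (iteratedSupport F D n M) = toFun^[n] (P.restrict M)

namespace SubstitutionMap

variable {Γ A : Type*} [Group Γ] (S : SubstitutionMap Γ A)

/-- `S` maps patches with full support to patches with full support. -/
theorem isSome_toFun_ofConfig (ω : Γ → A) (x : Γ) :
    (S.toFun (Patch.ofConfig ω) x).isSome := by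
  obtain ⟨⟨η, f⟩, ⟨hf, hx⟩, -⟩ := S.tiling x
  have hM : ({η} : Set Γ) ⊆ (Patch.ofConfig ω).supp := fun y _ => by
    simp [Patch.supp, Patch.ofConfig]
  have h1 := S.supp_iterate (Patch.ofConfig ω) {η} (Set.finite_singleton η) hM 1
  have h2 := S.restrict_iterate (Patch.ofConfig ω) {η} (Set.finite_singleton η) hM 1
  have hxmem : x ∈ iteratedSupport S.F S.D 1 {η} := by
    simp only [iteratedSupport, Set.mem_singleton_iff, Set.iUnion_iUnion_eq_left]
    exact ⟨f, hf, hx⟩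
  have h3 := congrFun h2 x
  rw [← h1] at hxmem
  have h4 : ((S.toFun^[1] ((Patch.ofConfig ω).restrict {η})) x).isSome := hxmem
  rw [← h3, h1.symm, Patch.restrict, if_pos hxmem] at h4
  exact h4

/-- The restriction `S : A^Γ → A^Γ` of the substitution map to configurations. -/
def onConfig (ω : Γ → A) : Γ → A :=
  fun x => (S.toFun (Patch.ofConfig ω) x).get (S.isSome_toFun_ofConfig ω x)

theorem ofConfig_onConfig (ω : Γ → A) :
    Patch.ofConfig (S.onConfig ω) = S.toFun (Patch.ofConfig ω) := by
  funext x
  simp [Patch.ofConfig, onConfig]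

/-- A finite set `T ⊆ Γ` is a convenient testing domain of `S`. The functions `g` collect the
choices `γ(n, x)` and `γ(x)`. -/
structure IsConvenientTestingDomain [PseudoMetricSpace Γ] (T : Finset Γ) : Prop where
  ball_subset : ∀ r : ℝ, 0 < r → ∃ (m : ℕ) (g : ℕ → Γ → Γ), (∀ n, g n 1 = 1) ∧
    ∀ n, m ≤ n → ∀ x : Γ,
      x • ball (1 : Γ) r ⊆ iteratedSupport S.F S.D n (g n x • (T : Set Γ))
  translate_subset : ∃ g : Γ → Γ, g 1 = 1 ∧
    ∀ x : Γ, x • (T : Set Γ) ⊆ iteratedSupport S.F S.D 1 (g x • (T : Set Γ))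

/-- `ℓ ≥ 1` is an eventual period of the sequence of `T`-dictionaries `W(S^n(ω₀))_T`. -/
def IsEventualPeriod (T : Finset Γ) (ω₀ : Γ → A) (ℓ : ℕ) : Prop :=
  1 ≤ ℓ ∧ ∃ N : ℕ, ∀ n, N ≤ n →
    Patch.dictionary (S.onConfig^[n] ω₀) T = Patch.dictionary (S.onConfig^[n + ℓ] ω₀) T

end SubstitutionMap

/-! ### Schrödinger operators with finite range -/

/-- The translation action `(γω)(x) = ω(γ⁻¹x)` on configurations. -/
def shiftConfig {Γ A : Type*} [Group Γ] (γ : Γ) (ω : Γ → A) : Γ → A := fun x => ω (γ⁻¹ * x)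

/-- The Hilbert space `ℓ²(Γ)` of complex square summable functions. -/
noncomputable abbrev EllTwo (Γ : Type*) := lp (fun _ : Γ => ℂ) 2

namespace EllTwo

variable {Γ : Type*} [Group Γ]

theorem memℓp_mul_shift (c : Γ → ℂ) {C : ℝ} (hc : ∀ γ, ‖c γ‖ ≤ C) (η : Γ) (ψ : EllTwo Γ) :
    Memℓp (fun γ => c γ * ψ (γ * η)) 2 := by
  have h0 : (0 : ℝ) < (2 : ℝ≥0∞).toReal := by norm_num
  have hψ := (lp.memℓp ψ).summable h0
  refine memℓp_gen (Summable.of_nonneg_of_le (fun _ => by positivity) (fun γ => ?_)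
    (((Equiv.mulRight η).summable_iff.2 hψ).mul_left (C ^ (2 : ℝ≥0∞).toReal)))
  simp only [Function.comp, Equiv.coe_mulRight, norm_mul]
  rw [Real.mul_rpow (norm_nonneg _) (norm_nonneg _)]
  gcongr
  exact hc γ

theorem norm_mul_shift_le (c : Γ → ℂ) {C : ℝ} (hc : ∀ γ, ‖c γ‖ ≤ C) (η : Γ) (ψ : EllTwo Γ) :
    ‖(⟨fun γ => c γ * ψ (γ * η), memℓp_mul_shift c hc η ψ⟩ : EllTwo Γ)‖ ≤ C * ‖ψ‖ := by
  have h0 : (0 : ℝ) < (2 : ℝ≥0∞).toReal := by norm_num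
  have hC : 0 ≤ C := (norm_nonneg _).trans (hc 1)
  have hψ := (lp.memℓp ψ).summable h0
  refine lp.norm_le_of_tsum_le h0 (by positivity) ?_
  rw [Real.mul_rpow hC (norm_nonneg _), lp.norm_rpow_eq_tsum h0,
    ← (Equiv.mulRight η).tsum_eq (fun γ => ‖ψ γ‖ ^ (2 : ℝ≥0∞).toReal), ← tsum_mul_left]
  refine Summable.tsum_le_tsum (fun γ => ?_) ((memℓp_mul_shift c hc η ψ).summable h0)
    (((Equiv.mulRight η).summable_iff.2 hψ).mul_left _)
  simp only [Equiv.coe_mulRight, norm_mul]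
  rw [Real.mul_rpow (norm_nonneg _) (norm_nonneg _)]
  gcongr
  exact hc γ

/-- The bounded operator `ψ ↦ (γ ↦ c(γ) ψ(γη))` on `ℓ²(Γ)`, for a bounded function `c`. -/
noncomputable def mulShift (c : Γ → ℂ) (hc : ∃ C : ℝ, ∀ γ, ‖c γ‖ ≤ C) (η : Γ) :
    EllTwo Γ →L[ℂ] EllTwo Γ :=
  LinearMap.mkContinuousOfExistsBound
    { toFun := fun ψ => ⟨fun γ => c γ * ψ (γ * η), memℓp_mul_shift c hc.choose_spec η ψ⟩
      map_add' := fun ψ φ => by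
        ext γ
        exact mul_add _ _ _
      map_smul' := fun z ψ => by
        ext γ
        simp [mul_left_comm] }
    ⟨hc.choose, fun ψ => norm_mul_shift_le c hc.choose_spec η ψ⟩

theorem mulShift_apply (c : Γ → ℂ) (hc : ∃ C : ℝ, ∀ γ, ‖c γ‖ ≤ C) (η : Γ) (ψ : EllTwo Γ)
    (γ : Γ) : mulShift c hc η ψ γ = c γ * ψ (γ * η) := rfl

end EllTwo

/-- The coefficients of a Schrödinger operator with finite range over `A^Γ`. The last condition,
with `(η⁻¹ω)(x) = ω(ηx)`, says that all operators `H_ω` below are self-adjoint. -/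
structure FiniteRangeSchrodinger (Γ A : Type*) [Group Γ] [TopologicalSpace A] where
  /-- the finite range -/
  B : Finset Γ
  inv_mem : ∀ η ∈ B, η⁻¹ ∈ B
  /-- the coefficients `t_η`, of which only those with `η ∈ B` matter -/
  t : Γ → (Γ → A) → ℂ
  continuous_t : ∀ η ∈ B, Continuous (t η)
  t_symm : ∀ η ∈ B, ∀ ω : Γ → A, t η ω = starRingEnd ℂ (t η⁻¹ (shiftConfig η⁻¹ ω))

namespace FiniteRangeSchrodinger

variable {Γ A : Type*} [Group Γ] [TopologicalSpace A] [Finite A] (H : FiniteRangeSchrodinger Γ A)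

theorem exists_bound (η : H.B) (ω : Γ → A) :
    ∃ C : ℝ, ∀ γ : Γ, ‖H.t η (shiftConfig γ⁻¹ ω)‖ ≤ C := by
  obtain ⟨C, hC⟩ := isCompact_univ.exists_bound_of_continuousOn
    (H.continuous_t η η.2).continuousOn
  exact ⟨C, fun γ => hC _ (Set.mem_univ _)⟩

/-- The operator `(H_ω ψ)(γ) = ∑_{η ∈ B} t_η(γ⁻¹ω) ψ(γη)` on `ℓ²(Γ)`. -/
noncomputable def op (ω : Γ → A) : EllTwo Γ →L[ℂ] EllTwo Γ :=
  ∑ η : H.B, EllTwo.mulShift (fun γ => H.t η (shiftConfig γ⁻¹ ω)) (H.exists_bound η ω) η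

theorem op_apply (ω : Γ → A) (ψ : EllTwo Γ) (γ : Γ) :
    H.op ω ψ γ = ∑ η ∈ H.B, H.t η (shiftConfig γ⁻¹ ω) * ψ (γ * η) := by
  rw [← Finset.sum_coe_sort]
  rw [op, sum_apply, lp.coeFn_sum, Finset.sum_apply]
  rfl

theorem isSelfAdjoint_op (ω : Γ → A) : IsSelfAdjoint (H.op ω) := by
  rw [ContinuousLinearMap.isSelfAdjoint_iff_isSymmetric]
  intro ψ φ
  let e : H.B ≃ H.B :=
    { toFun := fun η => ⟨(η : Γ)⁻¹, H.inv_mem η η.2⟩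
      invFun := fun η => ⟨(η : Γ)⁻¹, H.inv_mem η η.2⟩
      left_inv := fun η => by simp
      right_inv := fun η => by simp }
  simp only [ContinuousLinearMap.coe_coe, op, sum_apply, sum_inner, inner_sum]
  refine Fintype.sum_equiv e _ _ fun η => ?_
  rw [lp.inner_eq_tsum, lp.inner_eq_tsum, ← (Equiv.mulRight (η : Γ)).tsum_eq
    (fun γ => inner ℂ (ψ γ) ((EllTwo.mulShift (fun γ => H.t (e η) (shiftConfig γ⁻¹ ω))
      (H.exists_bound (e η) ω) (e η) φ : EllTwo Γ) γ))]
  refine tsum_congr fun γ => ?_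
  have h := H.t_symm η η.2 (shiftConfig γ⁻¹ ω)
  have h' : shiftConfig (η : Γ)⁻¹ (shiftConfig γ⁻¹ ω) = shiftConfig (γ * η)⁻¹ ω := by
    funext x
    simp [shiftConfig, mul_assoc]
  rw [h'] at h
  simp only [EllTwo.mulShift_apply, RCLike.inner_apply, Equiv.coe_mulRight, map_mul, h,
    RingHomCompTriple.comp_apply, RingHom.id_apply]
  simp only [e, Equiv.coe_fn_mk, mul_inv_cancel_right]
  ring

theorem spectrum_op_nonempty (ω : Γ → A) : (spectrum ℝ (H.op ω)).Nonempty := by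
  classical
  have hne : lp.single (E := fun _ : Γ => ℂ) 2 (1 : Γ) (1 : ℂ) ≠ 0 := fun h => by
    have h1 := congrArg (fun ψ : EllTwo Γ => ψ 1) h
    simp at h1
  have : Nontrivial (EllTwo Γ) := ⟨_, _, hne⟩
  obtain ⟨z, hz⟩ := spectrum.nonempty (H.op ω)
  let _ : CStarAlgebra (EllTwo Γ →L[ℂ] EllTwo Γ) := {}
  rw [IsSelfAdjoint.mem_spectrum_eq_re (H.isSelfAdjoint_op ω) hz] at hz
  exact ⟨z.re, spectrum.of_algebraMap_mem ℂ hz⟩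

/-- The spectrum `σ(H_ω) ⊆ ℝ`, a nonempty compact set. -/
noncomputable def spec (ω : Γ → A) : NonemptyCompacts ℝ where
  carrier := spectrum ℝ (H.op ω)
  isCompact' := spectrum.isCompact _
  nonempty' := H.spectrum_op_nonempty ω

end FiniteRangeSchrodinger

/-! Two independent facts combine. Combinatorial: `S^m(ω)` on `F(m, gT)` is determined, up to
translation, by `ω` on `gT` (`iterate_onConfig_congr`). Since every `xT` lies in some `F(1, gT)`,
the `T`-dictionary of `ω` determines that of `S(ω)`; there are finitely many `T`-dictionaries, so
they are eventually periodic. Since every translate of a finite `K` lies in some `F(m, gT)` with `m`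
independent of the translate, all `K`-dictionaries inherit the same period and become constant along
each progression `nℓ₀ + j`.

Spectral: up to `δ`, the spectrum depends only on a `K`-dictionary
(`exists_finset_forall_mem_spectrum`). An approximate eigenfunction of `H_ω` is cut off to some
`F(n, γT)` and transplanted to a place where `ω'` shows the same pattern. These sets cover `Γ` with
multiplicity at most `|T|` for every `n`, while the cutoffs vary as slowly as desired for large `n`;
hence the commutator error is small and no growth condition on `Γ` is needed. The spectra are
therefore Cauchy in a complete space. -/

/-! ### Dictionaries as sets of finite windows. -/

namespace Patch

variable {Γ A : Type*}

theorem supp_ofConfig (ω : Γ → A) : (ofConfig ω).supp = Set.univ := by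
  ext x; simp [supp, ofConfig]

theorem supp_restrict_ofConfig (ω : Γ → A) (M : Set Γ) : ((ofConfig ω).restrict M).supp = M := by
  ext x
  by_cases hx : x ∈ M <;> simp [supp, restrict, ofConfig, hx]

theorem restrict_apply_of_mem (P : Patch Γ A) {M : Set Γ} {x : Γ} (hx : x ∈ M) :
    P.restrict M x = P x := if_pos hx

theorem restrict_apply_of_notMem (P : Patch Γ A) {M : Set Γ} {x : Γ} (hx : x ∉ M) :
    P.restrict M x = none := if_neg hx

theorem finite_setOf_supp_eq [Finite A] (M : Finset Γ) :
    {P : Patch Γ A | P.supp = (M : Set Γ)}.Finite := by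
  classical
  refine (Set.finite_range fun (p : M → Option A) (x : Γ) =>
    if h : x ∈ M then p ⟨x, h⟩ else none).subset fun P hP => ⟨fun x => P x, funext fun x => ?_⟩
  by_cases hx : x ∈ M
  · simp [hx]
  · have : x ∉ supp P := by rw [show supp P = M from hP]; exact hx
    simp only [supp, Set.mem_ofPred_eq, Bool.not_eq_true, Option.isSome_eq_false_iff,
      Option.isNone_iff_eq_none] at this
    simp [hx, this]

variable [Group Γ]

/-- A dictionary consists of the patches seen from the points of the configuration. -/
theorem dictionary_eq_range (ω : Γ → A) (M : Finset Γ) :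
    dictionary ω M = Set.range fun γ : Γ => (ofConfig (fun x => ω (γ * x))).restrict (M : Set Γ) := by
  ext P
  simp only [dictionary, IsSubpatch, Set.mem_ofPred_eq, Set.mem_range]
  constructor
  · rintro ⟨hP, γ, -, h⟩
    refine ⟨γ, funext fun x => ?_⟩
    have hx := congrFun h (γ * x)
    simp only [translate, inv_mul_cancel_left] at hx
    rw [hx, hP]
    by_cases hxM : x ∈ (M : Set Γ)
    · rw [restrict_apply_of_mem _ hxM, ← smul_eq_mul,
        restrict_apply_of_mem _ (Set.smul_mem_smul_set hxM)]
      rfl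
    · rw [restrict_apply_of_notMem _ hxM, restrict_apply_of_notMem]
      rwa [← smul_eq_mul, Set.smul_mem_smul_set_iff]
  · rintro ⟨γ, rfl⟩
    rw [supp_restrict_ofConfig]
    refine ⟨rfl, γ, by simp [supp_ofConfig], funext fun x => ?_⟩
    by_cases hx : γ⁻¹ * x ∈ (M : Set Γ)
    · rw [translate, restrict_apply_of_mem _ hx, restrict_apply_of_mem]
      · simp [ofConfig]
      · rwa [Set.mem_smul_set_iff_inv_smul_mem]
    · rw [translate, restrict_apply_of_notMem _ hx, restrict_apply_of_notMem]
      rwa [Set.mem_smul_set_iff_inv_smul_mem]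

theorem dictionary_subset_iff (ω ω' : Γ → A) (M : Finset Γ) :
    dictionary ω M ⊆ dictionary ω' M ↔
      ∀ γ : Γ, ∃ γ' : Γ, ∀ x ∈ M, ω' (γ' * x) = ω (γ * x) := by
  simp only [dictionary_eq_range, Set.range_subset_iff, Set.mem_range]
  refine forall_congr' fun γ => exists_congr fun γ' => ⟨fun h x hx => ?_, fun h => ?_⟩
  · have := congrFun h x
    rw [restrict_apply_of_mem _ (Finset.mem_coe.2 hx),
      restrict_apply_of_mem _ (Finset.mem_coe.2 hx)] at this
    simpa [ofConfig] using this
  · funext x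
    by_cases hx : x ∈ (M : Set Γ)
    · rw [restrict_apply_of_mem _ hx, restrict_apply_of_mem _ hx]
      exact congrArg some (h x hx)
    · rw [restrict_apply_of_notMem _ hx, restrict_apply_of_notMem _ hx]

theorem finite_range_dictionary [Finite A] {ι : Type*} (ω : ι → Γ → A) (M : Finset Γ) :
    (Set.range fun i => dictionary (ω i) M).Finite :=
  (finite_setOf_supp_eq M).finite_subsets.subset fun _ ⟨_, hi⟩ => hi ▸ fun _ hP => hP.1

end Patch

/-! ### Locality of substitutions and periodicity of dictionaries. -/

namespace SubstitutionMap

variable {Γ A : Type*} [Group Γ] (S : SubstitutionMap Γ A)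

theorem ofConfig_iterate_onConfig (n : ℕ) (ω : Γ → A) :
    Patch.ofConfig (S.onConfig^[n] ω) = S.toFun^[n] (Patch.ofConfig ω) := by
  induction n with
  | zero => rfl
  | succ n ih => rw [Function.iterate_succ_apply', Function.iterate_succ_apply',
      ofConfig_onConfig, ih]

theorem iterate_toFun_translate (n : ℕ) (γ : Γ) (P : Patch Γ A) :
    S.toFun^[n] (Patch.translate γ P) = Patch.translate (S.D^[n] γ) (S.toFun^[n] P) := by
  induction n with
  | zero => rfl
  | succ n ih => simp only [Function.iterate_succ_apply', ih, S.map_translate]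

/-- The point `η` with `x ∈ D(η)F`. -/
noncomputable def parent (x : Γ) : Γ := (S.tiling x).choose.1

theorem mem_smul_F_iff (η x : Γ) : x ∈ S.D η • (S.F : Set Γ) ↔ S.parent x = η := by
  obtain ⟨⟨h1, h2⟩, h3⟩ := (S.tiling x).choose_spec
  constructor
  · rintro ⟨f, hf, rfl⟩
    exact congrArg Prod.fst (h3 (η, f) ⟨hf, rfl⟩).symm
  · rintro rfl
    exact ⟨_, h1, h2⟩

/-- The tiling makes `F(n, M)` the preimage of `M` under the `n`-th iterate of `parent`;
equivariance and multiplicity of these sets are read off from this. -/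
theorem mem_iteratedSupport_iff (n : ℕ) (M : Set Γ) (x : Γ) :
    x ∈ iteratedSupport S.F S.D n M ↔ S.parent^[n] x ∈ M := by
  induction n generalizing x with
  | zero => rfl
  | succ n ih => simp [iteratedSupport, mem_smul_F_iff, ih, Function.iterate_succ_apply]

theorem finite_iteratedSupport (n : ℕ) {M : Set Γ} (hM : M.Finite) :
    (iteratedSupport S.F S.D n M).Finite := by
  induction n with
  | zero => exact hM
  | succ n ih => exact ih.biUnion fun η _ => S.F.finite_toSet.smul_set

theorem parent_D_mul (δ x : Γ) : S.parent (S.D δ * x) = δ * S.parent x := by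
  rw [← mem_smul_F_iff, map_mul, ← smul_smul, ← smul_eq_mul, Set.smul_mem_smul_set_iff,
    mem_smul_F_iff]

theorem parent_iterate_D_mul (n : ℕ) (δ x : Γ) :
    S.parent^[n] (S.D^[n] δ * x) = δ * S.parent^[n] x := by
  induction n generalizing x with
  | zero => rfl
  | succ n ih =>
    rw [Function.iterate_succ_apply' S.D, Function.iterate_succ_apply, parent_D_mul, ih,
      Function.iterate_succ_apply]

theorem iteratedSupport_smul (n : ℕ) (δ : Γ) (M : Set Γ) :
    iteratedSupport S.F S.D n (δ • M) = S.D^[n] δ • iteratedSupport S.F S.D n M := by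
  ext x
  obtain ⟨y, rfl⟩ : ∃ y, S.D^[n] δ * y = x := ⟨_, mul_inv_cancel_left _ x⟩
  rw [← smul_eq_mul, Set.smul_mem_smul_set_iff, mem_iteratedSupport_iff, smul_eq_mul,
    parent_iterate_D_mul, ← smul_eq_mul, Set.smul_mem_smul_set_iff, mem_iteratedSupport_iff]

/-- If two configurations agree on translates of `T`, then their images under `S^m` agree on the
corresponding translates of `F(m, T)`. -/
theorem iterate_onConfig_congr {T : Finset Γ} {ω ω' : Γ → A} {g g' : Γ}
    (h : ∀ t ∈ T, ω' (g' * t) = ω (g * t)) (m : ℕ) {y : Γ}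
    (hy : y ∈ iteratedSupport S.F S.D m (g • (T : Set Γ))) :
    S.onConfig^[m] ω' (S.D^[m] (g' * g⁻¹) * y) = S.onConfig^[m] ω y := by
  set δ := S.D^[m] (g' * g⁻¹)
  have hfin (k : Γ) : (k • (T : Set Γ)).Finite := T.finite_toSet.smul_set
  have hr (ω : Γ → A) (k : Γ) {x : Γ} (hx : x ∈ iteratedSupport S.F S.D m (k • (T : Set Γ))) :
      some (S.onConfig^[m] ω x) = S.toFun^[m] ((Patch.ofConfig ω).restrict (k • (T : Set Γ))) x := by
    rw [← S.restrict_iterate _ _ (hfin k) (by simp [Patch.supp_ofConfig]),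
      Patch.restrict_apply_of_mem _ hx, ← ofConfig_iterate_onConfig]
    rfl
  have htr : (Patch.ofConfig ω').restrict (g' • (T : Set Γ)) =
      Patch.translate (g' * g⁻¹) ((Patch.ofConfig ω).restrict (g • (T : Set Γ))) := by
    funext x
    have hmem : (g' * g⁻¹)⁻¹ * x ∈ g • (T : Set Γ) ↔ x ∈ g' • (T : Set Γ) := by
      simp [Set.mem_smul_set_iff_inv_smul_mem, mul_assoc]
    by_cases hx : x ∈ g' • (T : Set Γ)
    · rw [Patch.translate, Patch.restrict_apply_of_mem _ hx,
        Patch.restrict_apply_of_mem _ (hmem.2 hx)]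
      obtain ⟨t, ht, rfl⟩ := hx
      simpa [Patch.ofConfig, mul_assoc] using h t ht
    · rw [Patch.translate, Patch.restrict_apply_of_notMem _ hx,
        Patch.restrict_apply_of_notMem _ (mt hmem.1 hx)]
  have hδ : δ * y ∈ iteratedSupport S.F S.D m (g' • (T : Set Γ)) := by
    rw [show g' • (T : Set Γ) = (g' * g⁻¹) • g • (T : Set Γ) by simp [smul_smul],
      iteratedSupport_smul]
    exact Set.smul_mem_smul_set hy
  apply Option.some_injective
  rw [hr ω' g' hδ, hr ω g hy, htr, iterate_toFun_translate, Patch.translate, inv_mul_cancel_left]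

/-- Each `K`-window of `S^m(ω)` lies in the image of a `T`-window of `ω`, and a matching `T`-window
of `ω'` has the same image. It serves with `K = T`, `m = 1` for periodicity, and with arbitrary `K`
to spread the period. -/
theorem dictionary_iterate_subset {T K : Finset Γ} {m : ℕ}
    (hK : ∀ x : Γ, ∃ g : Γ, x • (K : Set Γ) ⊆ iteratedSupport S.F S.D m (g • (T : Set Γ)))
    {ω ω' : Γ → A} (h : Patch.dictionary ω T ⊆ Patch.dictionary ω' T) :
    Patch.dictionary (S.onConfig^[m] ω) K ⊆ Patch.dictionary (S.onConfig^[m] ω') K := by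
  rw [Patch.dictionary_subset_iff] at h ⊢
  intro x
  obtain ⟨g, hg⟩ := hK x
  obtain ⟨g', hg'⟩ := h g
  refine ⟨S.D^[m] (g' * g⁻¹) * x, fun k hk => ?_⟩
  rw [mul_assoc]
  exact S.iterate_onConfig_congr hg' m (hg (Set.smul_mem_smul_set hk))

theorem dictionary_iterate_congr {T K : Finset Γ} {m : ℕ}
    (hK : ∀ x : Γ, ∃ g : Γ, x • (K : Set Γ) ⊆ iteratedSupport S.F S.D m (g • (T : Set Γ)))
    {ω ω' : Γ → A} (h : Patch.dictionary ω T = Patch.dictionary ω' T) :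
    Patch.dictionary (S.onConfig^[m] ω) K = Patch.dictionary (S.onConfig^[m] ω') K :=
  (S.dictionary_iterate_subset hK h.subset).antisymm (S.dictionary_iterate_subset hK h.superset)

namespace IsConvenientTestingDomain

variable {S} [PseudoMetricSpace Γ] {T : Finset Γ}

theorem exists_isEventualPeriod [Finite A] (hT : S.IsConvenientTestingDomain T) (ω₀ : Γ → A) :
    ∃ ℓ : ℕ, S.IsEventualPeriod T ω₀ ℓ := by
  have hni : ¬ Function.Injective fun n : ℕ => Patch.dictionary (S.onConfig^[n] ω₀) T := fun h =>
    Set.infinite_range_of_injective h (Patch.finite_range_dictionary _ T)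
  have hT1 (x : Γ) : ∃ g : Γ, x • (T : Set Γ) ⊆ iteratedSupport S.F S.D 1 (g • (T : Set Γ)) := by
    obtain ⟨g, -, hg⟩ := hT.translate_subset
    exact ⟨g x, hg x⟩
  -- Each `T`-dictionary determines the next, so a single coincidence propagates to all later
  -- indices.
  have key (i ℓ : ℕ) (h : Patch.dictionary (S.onConfig^[i] ω₀) T =
      Patch.dictionary (S.onConfig^[i + ℓ] ω₀) T) (n : ℕ) (hn : i ≤ n) :
      Patch.dictionary (S.onConfig^[n] ω₀) T = Patch.dictionary (S.onConfig^[n + ℓ] ω₀) T := by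
    induction n, hn using Nat.le_induction with
    | base => exact h
    | succ n _ ih =>
      have := S.dictionary_iterate_congr hT1 ih
      rw [Nat.add_right_comm]
      simpa only [Function.iterate_succ_apply', Function.iterate_zero, id] using this
  simp only [Function.Injective, not_forall] at hni
  obtain ⟨i, j, hij, hne⟩ := hni
  wlog hlt : i < j generalizing i j
  · exact this j i hij.symm (Ne.symm hne) (by omega)
  obtain ⟨ℓ, rfl⟩ := Nat.exists_eq_add_of_le hlt.le
  exact ⟨ℓ, by omega, i, key i ℓ hij⟩

theorem exists_forall_smul_subset (hT : S.IsConvenientTestingDomain T) (K : Finset Γ) :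
    ∃ m : ℕ, ∀ x : Γ, ∃ g : Γ,
      x • (K : Set Γ) ⊆ iteratedSupport S.F S.D m (g • (T : Set Γ)) := by
  obtain ⟨r, hr⟩ := K.finite_toSet.isBounded.subset_ball (1 : Γ)
  -- The radius bounding `K` need not be positive, hence the maximum with 1.
  obtain ⟨m, g, -, h⟩ := hT.ball_subset (max r 1) (by positivity)
  exact ⟨m, fun x => ⟨g m x, (Set.smul_set_mono
    (hr.trans (ball_subset_ball (le_max_left _ _)))).trans (h m le_rfl x)⟩⟩

/-- The period does not depend on `K`; only the threshold grows, by the number `m` of substitution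
steps needed to cover `K`. -/
theorem dictionary_eventually_periodic (hT : S.IsConvenientTestingDomain T) {ω₀ : Γ → A} {ℓ : ℕ}
    (hℓ : S.IsEventualPeriod T ω₀ ℓ) (K : Finset Γ) :
    ∃ N : ℕ, ∀ n, N ≤ n →
      Patch.dictionary (S.onConfig^[n] ω₀) K = Patch.dictionary (S.onConfig^[n + ℓ] ω₀) K := by
  obtain ⟨m, hm⟩ := hT.exists_forall_smul_subset K
  obtain ⟨-, N, hN⟩ := hℓ
  refine ⟨N + m, fun n hn => ?_⟩
  obtain ⟨k, rfl⟩ := Nat.exists_eq_add_of_le hn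
  have := S.dictionary_iterate_congr hm (hN (N + k) (by omega))
  rw [← Function.iterate_add_apply, ← Function.iterate_add_apply] at this
  rwa [show m + (N + k) = N + m + k by omega, show m + (N + k + ℓ) = N + m + k + ℓ by omega] at this

end IsConvenientTestingDomain

end SubstitutionMap

/-! ### Distance to the spectrum and lower bounds. -/

section SpectralGap

variable {E : Type*} [NormedAddCommGroup E] [InnerProductSpace ℂ E] [CompleteSpace E]

/-- The distance of a real number to the spectrum of a self-adjoint operator is at least `δ` iff
the shifted operator is bounded below by `δ`. -/
theorem IsSelfAdjoint.forall_mem_spectrum_le_abs_sub_iff {a : E →L[ℂ] E} (ha : IsSelfAdjoint a)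
    (z : ℝ) {δ : ℝ} (hδ : 0 ≤ δ) :
    (∀ x ∈ spectrum ℝ a, δ ≤ |x - z|) ↔ ∀ ψ : E, δ * ‖ψ‖ ≤ ‖a ψ - (z : ℂ) • ψ‖ := by
  set b : E →L[ℂ] E := a - algebraMap ℝ _ z with hb
  have hbapp (ψ : E) : b ψ = a ψ - (z : ℂ) • ψ := by
    simp [hb, Algebra.algebraMap_eq_smul_one]
  have hbsa : IsSelfAdjoint b := ha.sub (.algebraMap _ (.all z))
  -- The gap condition says `(x - z)² - δ² ≥ 0` on the spectrum. By functional calculus this is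
  -- positivity of `b² - δ²`, whose quadratic form is `‖bψ‖² - δ²‖ψ‖²`.
  have hcfc : cfc (fun x : ℝ => (x - z) ^ 2 - δ ^ 2) a = b ^ 2 - algebraMap ℝ _ (δ ^ 2) := by
    have := cfc_polynomial (R := ℝ)
      ((Polynomial.X - Polynomial.C z) ^ 2 - Polynomial.C (δ ^ 2)) a ha
    simpa [-map_pow, map_pow (Polynomial.aeval a) (_ - _) 2, ← hb] using this
  have hpos := cfc_nonneg_iff (fun x : ℝ => (x - z) ^ 2 - δ ^ 2) a
    (by fun_prop) ha
  rw [hcfc, ContinuousLinearMap.nonneg_iff_isPositive,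
    ContinuousLinearMap.isPositive_iff_complex] at hpos
  have hinner (ψ : E) : inner ℂ ((b ^ 2 - algebraMap ℝ (E →L[ℂ] E) (δ ^ 2)) ψ) ψ =
      ((‖b ψ‖ ^ 2 - (δ * ‖ψ‖) ^ 2 : ℝ) : ℂ) := by
    have h1 : inner ℂ ((b ^ 2) ψ) ψ = ((‖b ψ‖ : ℂ)) ^ 2 := by
      rw [pow_two, show (b * b) ψ = b (b ψ) from rfl, ← ContinuousLinearMap.adjoint_inner_right,
        hbsa.adjoint_eq]
      exact inner_self_eq_norm_sq_to_K _
    have h2 : inner ℂ (algebraMap ℝ (E →L[ℂ] E) (δ ^ 2) ψ) ψ = (δ : ℂ) ^ 2 * (‖ψ‖ : ℂ) ^ 2 := by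
      have : algebraMap ℝ (E →L[ℂ] E) (δ ^ 2) ψ = ((δ ^ 2 : ℝ) : ℂ) • ψ := by
        rw [Algebra.algebraMap_eq_smul_one, Complex.coe_smul]; rfl
      rw [this, inner_smul_left, inner_self_eq_norm_sq_to_K]
      simp
    rw [sub_apply, inner_sub_left, h1, h2]
    push_cast
    ring
  have hl : (∀ x ∈ spectrum ℝ a, δ ≤ |x - z|) ↔
      ∀ x ∈ spectrum ℝ a, 0 ≤ (x - z) ^ 2 - δ ^ 2 := by
    refine forall₂_congr fun x _ => ?_
    rw [sub_nonneg, ← sq_abs (x - z), pow_le_pow_iff_left₀ hδ (abs_nonneg _) two_ne_zero]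
  rw [hl, ← hpos]
  refine forall_congr' fun ψ => ?_
  rw [hinner, ← hbapp, ← pow_le_pow_iff_left₀ (by positivity) (norm_nonneg (b ψ)) two_ne_zero,
    RCLike.re_eq_complex_re, Complex.ofReal_re, sub_nonneg]
  exact and_iff_right rfl

end SpectralGap

/-! ### Square sums in `[0, ∞]`, where sums can be interchanged freely. -/

/-- The squared `ℓ²`-norm of a function, with values in `[0, ∞]`. -/
noncomputable def sqENorm {Γ : Type*} (f : Γ → ℂ) : ℝ≥0∞ := ∑' x, ‖f x‖ₑ ^ 2

/-- The action on functions of a finite range operator with coefficients `c`. -/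
def finiteRangeSum {Γ : Type*} [Group Γ] (B : Finset Γ) (c : Γ → Γ → ℂ) (f : Γ → ℂ) (x : Γ) : ℂ :=
  ∑ η ∈ B, c η x * f (x * η)

theorem Complex.enorm_ofReal (r : ℝ) : ‖(r : ℂ)‖ₑ = ‖r‖ₑ :=
  congrArg ENNReal.ofNNReal (Complex.nnnorm_real r)

theorem ENNReal.add_sq_le (a b : ℝ≥0∞) : (a + b) ^ 2 ≤ 2 * a ^ 2 + 2 * b ^ 2 := by
  have := ENNReal.rpow_add_le_mul_rpow_add_rpow a b (p := 2) (by norm_num)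
  norm_num at this
  rwa [mul_add] at this

theorem ENNReal.sum_sq_le_card_mul {ι : Type*} (s : Finset ι) (f : ι → ℝ≥0∞) :
    (∑ i ∈ s, f i) ^ 2 ≤ s.card * ∑ i ∈ s, f i ^ 2 := by
  have := ENNReal.rpow_sum_le_const_mul_sum_rpow s f (p := 2) (by norm_num)
  norm_num at this
  exact this

section SqENorm

variable {Γ : Type*}

theorem sqENorm_add_le (f g : Γ → ℂ) :
    sqENorm (fun x => f x + g x) ≤ 2 * sqENorm f + 2 * sqENorm g := by
  simp only [sqENorm, ← ENNReal.tsum_mul_left, ← ENNReal.tsum_add]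
  exact ENNReal.tsum_le_tsum fun x =>
    (pow_le_pow_left' (enorm_add_le _ _) 2).trans (ENNReal.add_sq_le _ _)

theorem sqENorm_comp_equiv {Γ' : Type*} (e : Γ ≃ Γ') (f : Γ' → ℂ) :
    sqENorm (fun x => f (e x)) = sqENorm f :=
  e.tsum_eq fun x => ‖f x‖ₑ ^ 2

theorem sqENorm_lp (ψ : EllTwo Γ) : sqENorm ψ = ENNReal.ofReal (‖ψ‖ ^ 2) := by
  have h0 : (0 : ℝ) < (2 : ℝ≥0∞).toReal := by norm_num
  have h := lp.norm_rpow_eq_tsum h0 ψ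
  have hs := (lp.memℓp ψ).summable h0
  simp only [ENNReal.toReal_ofNat, Real.rpow_ofNat] at h hs
  rw [h, ENNReal.ofReal_tsum_of_nonneg (fun _ => by positivity) hs]
  refine tsum_congr fun x => ?_
  rw [ENNReal.ofReal_pow (norm_nonneg _), ofReal_norm]

variable [Group Γ]

/-- Cauchy–Schwarz over `B` gives one factor `|B|`; the other counts the shifts by `η`, each of
which preserves the square sum. -/
theorem sqENorm_sum_shift_le (B : Finset Γ) (a : Γ → Γ → ℂ) (f : Γ → ℂ) (K : ℝ≥0∞)
    (h : ∀ η ∈ B, ∀ x, ‖a η x‖ₑ ≤ K * ‖f (x * η)‖ₑ) :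
    sqENorm (fun x => ∑ η ∈ B, a η x) ≤ B.card ^ 2 * K ^ 2 * sqENorm f := by
  calc sqENorm (fun x => ∑ η ∈ B, a η x)
      ≤ ∑' x, B.card * ∑ η ∈ B, (K * ‖f (x * η)‖ₑ) ^ 2 :=
        ENNReal.tsum_le_tsum fun x => (pow_le_pow_left' (enorm_sum_le _ _) 2).trans
          ((ENNReal.sum_sq_le_card_mul _ _).trans (by gcongr with η hη; exact h η hη x))
    _ = B.card * ∑ η ∈ B, ∑' x, (K * ‖f (x * η)‖ₑ) ^ 2 := by
        rw [ENNReal.tsum_mul_left, Summable.tsum_finsetSum fun _ _ => ENNReal.summable]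
    _ = B.card * ∑ η ∈ B, K ^ 2 * sqENorm f := by
        congr 1
        refine Finset.sum_congr rfl fun η _ => ?_
        simp only [mul_pow, ENNReal.tsum_mul_left]
        congr 1
        exact (Equiv.mulRight η).tsum_eq fun x => ‖f x‖ₑ ^ 2
    _ = B.card ^ 2 * K ^ 2 * sqENorm f := by
        rw [Finset.sum_const, nsmul_eq_mul]; ring

/-- Changing the coefficients near the support of `φ` by at most `ε`. -/
theorem sqENorm_finiteRangeSum_sub_le (B : Finset Γ) (c c' : Γ → Γ → ℂ) (φ : Γ → ℂ) (ε : ℝ≥0∞)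
    (h : ∀ η ∈ B, ∀ x, φ (x * η) ≠ 0 → ‖c η x - c' η x‖ₑ ≤ ε) :
    sqENorm (fun x => finiteRangeSum B c φ x - finiteRangeSum B c' φ x) ≤
      B.card ^ 2 * ε ^ 2 * sqENorm φ := by
  simp only [finiteRangeSum, ← Finset.sum_sub_distrib, ← sub_mul]
  refine sqENorm_sum_shift_le B _ φ ε fun η hη x => ?_
  rw [enorm_mul]
  by_cases h0 : φ (x * η) = 0
  · simp [h0]
  · gcongr
    exact h η hη x h0

end SqENorm

/-! ### Localization by cutoff functions. -/

/-- A family of cutoff functions, of multiplicity at most `N`, which varies by at most `κ` along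
the elements of `B`. -/
structure IsCutoffFamily {Γ ι : Type*} [Group Γ] (B : Finset Γ) (U : ι → Set Γ) (h : ι → Γ → ℝ)
    (N : ℕ) (κ : ℝ≥0∞) : Prop where
  enorm_le_one : ∀ i x, ‖h i x‖ₑ ≤ 1
  eq_zero : ∀ i, ∀ x ∉ U i, h i x = 0
  exists_eq_one : ∀ x, ∃ i, h i x = 1
  encard_le : ∀ x, {i | x ∈ U i}.encard ≤ N
  enorm_sub_le : ∀ i x, ∀ η ∈ B, ‖h i (x * η) - h i x‖ₑ ≤ κ

namespace IsCutoffFamily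

variable {Γ ι : Type*} [Group Γ] {B : Finset Γ} {U : ι → Set Γ} {h : ι → Γ → ℝ}
    {N : ℕ} {κ : ℝ≥0∞}

theorem tsum_le_of_forall_eq_zero (hh : IsCutoffFamily B U h N κ) (x : Γ) (u : ι → ℝ≥0∞)
    (K : ℝ≥0∞) (hu : ∀ i, u i ≤ K) (h0 : ∀ i, x ∉ U i → u i = 0) : ∑' i, u i ≤ N * K := by
  calc ∑' i, u i = ∑' i : {i | x ∈ U i}, u i := by
        refine (tsum_subtype_eq_of_support_subset fun i hi => ?_).symm
        by_contra hx
        exact hi (h0 i hx)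
    _ ≤ ∑' _ : {i | x ∈ U i}, K := ENNReal.tsum_le_tsum fun i => hu i
    _ = ({i | x ∈ U i}.encard : ℝ≥0∞) * K := ENNReal.tsum_set_const _ _
    _ ≤ N * K := by
        gcongr
        exact_mod_cast hh.encard_le x

theorem sqENorm_le_tsum (hh : IsCutoffFamily B U h N κ) (f : Γ → ℂ) :
    sqENorm f ≤ ∑' i, sqENorm fun x => h i x * f x := by
  simp only [sqENorm]
  rw [ENNReal.tsum_comm]
  refine ENNReal.tsum_le_tsum fun x => ?_
  obtain ⟨i, hi⟩ := hh.exists_eq_one x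
  refine le_trans (by simp [hi]) (ENNReal.le_tsum i)

theorem tsum_sqENorm_le (hh : IsCutoffFamily B U h N κ) (f : Γ → ℂ) :
    ∑' i, sqENorm (fun x => h i x * f x) ≤ N * sqENorm f := by
  simp only [sqENorm]
  rw [ENNReal.tsum_comm, ← ENNReal.tsum_mul_left]
  refine ENNReal.tsum_le_tsum fun x => hh.tsum_le_of_forall_eq_zero x _ _ (fun i => ?_)
    fun i hi => by simp [hh.eq_zero i x hi]
  refine pow_le_pow_left' ?_ 2
  rw [enorm_mul]
  refine mul_le_of_le_one_left' ?_
  rw [Complex.enorm_ofReal]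
  exact hh.enorm_le_one i x

/-- The total size of the commutators of a finite range operator with the cutoff functions. -/
theorem tsum_sqENorm_commutator_le (hh : IsCutoffFamily B U h N κ) (c : Γ → Γ → ℂ) (C : ℝ≥0∞)
    (hc : ∀ η ∈ B, ∀ x, ‖c η x‖ₑ ≤ C) (ψ : Γ → ℂ) :
    ∑' i, sqENorm (fun x => finiteRangeSum B c (fun y => h i y * ψ y) x
      - h i x * finiteRangeSum B c ψ x) ≤ B.card ^ 2 * (C * κ) ^ 2 * (2 * N) * sqENorm ψ := by
  -- The commutator has coefficients `c η x * (h(xη) - h(x))`: of size at most `Cκ`, and zero unless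
  -- `x` or `xη` lies in `U i`, which leaves at most `2N` indices.
  have hrw (i : ι) (x : Γ) : finiteRangeSum B c (fun y => h i y * ψ y) x
      - h i x * finiteRangeSum B c ψ x =
      ∑ η ∈ B, c η x * ((h i (x * η) - h i x : ℝ) * ψ (x * η)) := by
    simp only [finiteRangeSum, Finset.mul_sum, ← Finset.sum_sub_distrib]
    refine Finset.sum_congr rfl fun η _ => ?_
    push_cast
    ring
  simp only [hrw, sqENorm]
  rw [ENNReal.tsum_comm]
  have hterm (x η : Γ) (hη : η ∈ B) :
      ∑' i, ‖c η x * ((h i (x * η) - h i x : ℝ) * ψ (x * η))‖ₑ ^ 2 ≤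
        (2 * N) * ((C * κ) ^ 2 * ‖ψ (x * η)‖ₑ ^ 2) := by
    classical
    set K := (C * κ) ^ 2 * ‖ψ (x * η)‖ₑ ^ 2
    have hb (i : ι) : ‖c η x * ((h i (x * η) - h i x : ℝ) * ψ (x * η))‖ₑ ^ 2 ≤ K := by
      rw [show K = _ from (mul_pow _ _ 2).symm, mul_assoc, enorm_mul, enorm_mul, Complex.enorm_ofReal]
      gcongr
      · exact hc η hη x
      · exact hh.enorm_sub_le i x η hη
    calc _ ≤ ∑' i, ((if x ∈ U i then K else 0) + if x * η ∈ U i then K else 0) := by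
          refine ENNReal.tsum_le_tsum fun i => ?_
          by_cases h1 : x ∈ U i
          · simp only [h1, if_true]
            exact (hb i).trans le_self_add
          by_cases h2 : x * η ∈ U i
          · simp only [h2, if_true]
            exact (hb i).trans le_add_self
          simp [hh.eq_zero i _ h1, hh.eq_zero i _ h2]
      _ ≤ N * K + N * K := by
          rw [ENNReal.tsum_add]
          gcongr
          · exact hh.tsum_le_of_forall_eq_zero x _ _ (fun i => by split_ifs <;> simp)
              fun i hi => if_neg hi
          · exact hh.tsum_le_of_forall_eq_zero (x * η) _ _ (fun i => by split_ifs <;> simp)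
              fun i hi => if_neg hi
      _ = _ := by ring
  calc _ ≤ ∑' x, (B.card : ℝ≥0∞) * ∑ η ∈ B, (2 * N : ℝ≥0∞) * ((C * κ) ^ 2 * ‖ψ (x * η)‖ₑ ^ 2) := by
        refine ENNReal.tsum_le_tsum fun x => ?_
        calc _ ≤ ∑' i, B.card * ∑ η ∈ B,
              ‖c η x * ((h i (x * η) - h i x : ℝ) * ψ (x * η))‖ₑ ^ 2 :=
              ENNReal.tsum_le_tsum fun i => (pow_le_pow_left' (enorm_sum_le _ _) 2).trans
                (ENNReal.sum_sq_le_card_mul _ _)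
          _ ≤ _ := by
              rw [ENNReal.tsum_mul_left, Summable.tsum_finsetSum fun _ _ => ENNReal.summable]
              gcongr with η hη
              exact hterm x η hη
    _ = (B.card : ℝ≥0∞) * ∑ η ∈ B, (2 * N : ℝ≥0∞) * ((C * κ) ^ 2 * sqENorm ψ) := by
        rw [ENNReal.tsum_mul_left, Summable.tsum_finsetSum fun _ _ => ENNReal.summable]
        congr 1
        refine Finset.sum_congr rfl fun η _ => ?_
        simp only [ENNReal.tsum_mul_left]
        congr 2
        exact (Equiv.mulRight η).tsum_eq fun x => ‖ψ x‖ₑ ^ 2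
    _ = _ := by
        rw [Finset.sum_const, nsmul_eq_mul, ← sqENorm]; ring

/-- An approximate eigenfunction of a finite range operator can be localized by one of the cutoff
functions. -/
theorem exists_localized (hh : IsCutoffFamily B U h N κ) (c : Γ → Γ → ℂ) (C : ℝ≥0∞)
    (hc : ∀ η ∈ B, ∀ x, ‖c η x‖ₑ ≤ C) (z : ℂ) {ψ : Γ → ℂ} (h0 : sqENorm ψ ≠ 0)
    (htop : sqENorm ψ ≠ ∞) {a b : ℝ≥0∞}
    (hψ : sqENorm (fun x => finiteRangeSum B c ψ x - z * ψ x) ≤ a * sqENorm ψ)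
    (hab : 2 * N * a + 4 * N * B.card ^ 2 * (C * κ) ^ 2 < b) :
    ∃ i, sqENorm (fun x => h i x * ψ x) ≠ 0 ∧
      sqENorm (fun x => finiteRangeSum B c (fun y => h i y * ψ y) x - z * (h i x * ψ x)) ≤
        b * sqENorm (fun x => h i x * ψ x) := by
  -- If every nonzero piece failed, summing over `i` would contradict `hab`. The splitting is `(H -
  -- z)(hψ) = h(H - z)ψ + [H, h]ψ`; the doubled first term contributes `2Na` and the doubled
  -- commutator the rest.
  by_contra! hcon
  have h1 (i : ι) : b * sqENorm (fun x => h i x * ψ x) ≤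
      sqENorm (fun x => finiteRangeSum B c (fun y => h i y * ψ y) x - z * (h i x * ψ x)) := by
    by_cases hi : sqENorm (fun x => h i x * ψ x) = 0
    · simp [hi]
    · exact (hcon i hi).le
  have h2 (i : ι) :
      sqENorm (fun x => finiteRangeSum B c (fun y => h i y * ψ y) x - z * (h i x * ψ x)) ≤
        2 * sqENorm (fun x => h i x * (finiteRangeSum B c ψ x - z * ψ x)) +
        2 * sqENorm (fun x => finiteRangeSum B c (fun y => h i y * ψ y) x
          - h i x * finiteRangeSum B c ψ x) := by
    refine le_of_eq_of_le ?_ (sqENorm_add_le _ _)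
    congr 1
    funext x
    ring
  have : b * sqENorm ψ ≤ (2 * N * a + 4 * N * B.card ^ 2 * (C * κ) ^ 2) * sqENorm ψ :=
    calc b * sqENorm ψ ≤ ∑' i, b * sqENorm (fun x => h i x * ψ x) := by
          rw [ENNReal.tsum_mul_left]
          gcongr
          exact hh.sqENorm_le_tsum ψ
      _ ≤ _ := ENNReal.tsum_le_tsum fun i => (h1 i).trans (h2 i)
      _ ≤ 2 * (N * (a * sqENorm ψ)) +
          2 * (B.card ^ 2 * (C * κ) ^ 2 * (2 * N) * sqENorm ψ) := by
          rw [ENNReal.tsum_add, ENNReal.tsum_mul_left, ENNReal.tsum_mul_left]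
          gcongr
          · exact (hh.tsum_sqENorm_le _).trans (by gcongr)
          · exact hh.tsum_sqENorm_commutator_le c C hc ψ
      _ = _ := by ring
  exact absurd hab (not_lt.2 ((ENNReal.mul_le_mul_iff_left h0 htop).1 this))

end IsCutoffFamily
-- Finite dependence of coefficients, and cutoffs from a testing domain.
open scoped NNReal

/-- A continuous function on configurations depends only on finitely many letters, up to `ε`. -/
theorem exists_finset_forall_norm_sub_le {Γ A E : Type*} [Finite A] [TopologicalSpace A]
    [DiscreteTopology A] [SeminormedAddCommGroup E] {t : (Γ → A) → E} (ht : Continuous t) {ε : ℝ}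
    (hε : 0 < ε) :
    ∃ K : Finset Γ, ∀ ω ω' : Γ → A, (∀ k ∈ K, ω k = ω' k) → ‖t ω - t ω'‖ ≤ ε := by
  classical
  have hcyl (ω : Γ → A) : ∃ I : Finset Γ, ∀ ω', (∀ k ∈ I, ω' k = ω k) → ‖t ω' - t ω‖ < ε / 2 := by
    have hopen : IsOpen {ω' | ‖t ω' - t ω‖ < ε / 2} :=
      isOpen_lt (by fun_prop) continuous_const
    obtain ⟨I, u, hu, hI⟩ := isOpen_pi_iff.1 hopen ω (by simpa using hε)
    exact ⟨I, fun ω' h => hI fun k hk => by rw [h k hk]; exact (hu k hk).2⟩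
  choose I hI using hcyl
  obtain ⟨s, -, hs⟩ := isCompact_univ.elim_nhds_subcover
    (fun ω : Γ → A => {ω' | ∀ k ∈ I ω, ω' k = ω k}) fun ω _ => by
      refine IsOpen.mem_nhds ?_ (by simp)
      have := isOpen_set_pi (I ω).finite_toSet fun k _ => isOpen_discrete ({ω k} : Set A)
      convert this using 1
      ext ω'
      simp
  refine ⟨s.biUnion I, fun ω ω' h => ?_⟩
  obtain ⟨ω₁, hω₁, hω⟩ := Set.mem_iUnion₂.1 (hs (Set.mem_univ ω))
  have h1 := hI ω₁ ω hω
  have h2 := hI ω₁ ω' fun k hk =>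
    (h k (Finset.mem_biUnion.2 ⟨ω₁, hω₁, hk⟩)).symm.trans (hω k hk)
  calc ‖t ω - t ω'‖ = ‖(t ω - t ω₁) - (t ω' - t ω₁)‖ := by congr 1; abel
    _ ≤ ‖t ω - t ω₁‖ + ‖t ω' - t ω₁‖ := norm_sub_le _ _
    _ ≤ ε := by linarith

namespace SubstitutionMap.IsConvenientTestingDomain

variable {Γ A : Type*} [Group Γ] {S : SubstitutionMap Γ A} {T : Finset Γ}

/-- Membership forces `γ = y * t⁻¹` with `t ∈ T`, where `y` is the `n`-fold parent of `x`. The bound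
is uniform in `n`, so slow variation costs no multiplicity. -/
theorem encard_setOf_mem_iteratedSupport_le (S : SubstitutionMap Γ A) (T : Finset Γ) (n : ℕ)
    (x : Γ) :
    {γ : Γ | x ∈ iteratedSupport S.F S.D n (γ • (T : Set Γ))}.encard ≤ T.card := by
  classical
  rw [← Set.encard_coe_eq_coe_finsetCard]
  refine (Set.encard_le_encard (t := (fun t => S.parent^[n] x * t⁻¹) '' (T : Set Γ)) ?_).trans
    (Set.encard_image_le _ _)
  intro γ hγ
  obtain ⟨t, ht, h⟩ := (S.mem_iteratedSupport_iff n _ x).1 hγ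
  exact ⟨t, ht, by simp [← h]⟩

/-- The translates of a convenient testing domain give cutoff functions of multiplicity at most
`|T|` which vary arbitrarily slowly. -/
theorem exists_isCutoffFamily [MetricSpace Γ] [IsIsometricSMul Γ Γ]
    (hT : S.IsConvenientTestingDomain T) (B : Finset Γ) {κ : ℝ≥0} (hκ : 0 < κ) :
    ∃ (n : ℕ) (h : Γ → Γ → ℝ),
      IsCutoffFamily B (fun γ => iteratedSupport S.F S.D n (γ • (T : Set Γ))) h T.card κ := by
  obtain ⟨L, hL⟩ : ∃ L : ℝ, ∀ η ∈ B, dist η 1 < L := by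
    obtain ⟨L, hL⟩ := B.finite_toSet.isBounded.subset_ball (1 : Γ)
    exact ⟨L, fun η hη => hL hη⟩
  -- The cutoffs below are `1/r`-Lipschitz and right multiplication by `B` moves points by less than
  -- `L`, so this radius gives variation at most `κ`.
  set r : ℝ := max L 1 / κ with hr_def
  have hr : 0 < r := by positivity
  obtain ⟨n, g, -, hg⟩ := hT.ball_subset r hr
  set U : Γ → Set Γ := fun γ => iteratedSupport S.F S.D n (γ • (T : Set Γ))
  set f : Γ → Γ → ℝ≥0 := fun γ => thickenedIndicator hr (U γ)ᶜ
  have hf1 (γ x : Γ) : (f γ x : ℝ) ≤ 1 := by exact_mod_cast thickenedIndicator_le_one hr _ x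
  refine ⟨n, fun γ x => 1 - f γ x, fun γ x => ?_, fun γ x hx => ?_, fun x => ⟨g n x, ?_⟩,
    encard_setOf_mem_iteratedSupport_le S T n, fun γ x η hη => ?_⟩
  · rw [Real.enorm_eq_ofReal (sub_nonneg.2 (hf1 γ x))]
    exact ENNReal.ofReal_le_one.2 (by simp)
  · simp only [f]
    rw [thickenedIndicator_one hr _ hx]
    simp
  -- By left invariance `x • ball 1 r` is the ball around `x`. It lies in `U (g n x)`, so `x` has
  -- distance at least `r` from the complement.
  · have h0 : f (g n x) x = 0 := by
      refine thickenedIndicator_zero hr _ fun hx => ?_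
      obtain ⟨y, hy, hxy⟩ := mem_thickening_iff.1 hx
      refine hy (hg n le_rfl x ?_)
      rw [Set.mem_smul_set_iff_inv_smul_mem, mem_ball, ← dist_smul x]
      simpa [dist_comm] using hxy
    simp [h0]
  · have hdist : dist (f γ x) (f γ (x * η)) ≤ κ := by
      refine ((lipschitzWith_thickenedIndicator hr (U γ)ᶜ).dist_le_mul x (x * η)).trans ?_
      have hx : dist x (x * η) ≤ max L 1 := by
        have := dist_smul x (1 : Γ) η
        simp only [smul_eq_mul, mul_one] at this
        rw [this, dist_comm]
        exact (hL η hη).le.trans (le_max_left _ _)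
      rw [NNReal.coe_inv, Real.coe_toNNReal _ hr.le, inv_mul_le_iff₀ hr, hr_def,
        div_mul_cancel₀ _ (by positivity)]
      exact hx
    rw [← ofReal_norm, ENNReal.ofReal_le_iff_le_toReal ENNReal.coe_ne_top, ENNReal.coe_toReal]
    rw [NNReal.dist_eq] at hdist
    rw [Real.norm_eq_abs]
    convert hdist using 2
    ring

end SubstitutionMap.IsConvenientTestingDomain

/-! ### Transplanting approximate eigenfunctions. -/

namespace FiniteRangeSchrodinger

section Coefficients

variable {Γ A : Type*} [Group Γ] [TopologicalSpace A] (H : FiniteRangeSchrodinger Γ A)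

/-- The coefficients of `H_ω`. -/
def coeff (ω : Γ → A) (η x : Γ) : ℂ := H.t η (shiftConfig x⁻¹ ω)

/-- Translating a function that lives on `δV` to a place where `ω'` looks like `ω`. -/
theorem sqENorm_transplant_le {ω ω' : Γ → A} {τ : Γ} (φ : Γ → ℂ) {ε b : ℝ≥0} {z : ℂ}
    (hcoeff : ∀ η ∈ H.B, ∀ x, φ (x * η) ≠ 0 → ‖H.coeff ω η x - H.coeff ω' η (τ * x)‖ₑ ≤ ε)
    (hφ : sqENorm (fun x => finiteRangeSum H.B (H.coeff ω) φ x - z * φ x) ≤ b * sqENorm φ) :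
    sqENorm (fun x => finiteRangeSum H.B (H.coeff ω') (fun y => φ (τ⁻¹ * y)) x
        - z * φ (τ⁻¹ * x)) ≤
      (2 * b + 2 * (H.B.card ^ 2 * ε ^ 2)) * sqENorm fun y => φ (τ⁻¹ * y) := by
  rw [show sqENorm (fun y => φ (τ⁻¹ * y)) = sqENorm φ from
      sqENorm_comp_equiv (Equiv.mulLeft τ⁻¹) φ,
    ← sqENorm_comp_equiv (Equiv.mulLeft τ)]
  set c' : Γ → Γ → ℂ := fun η x => H.coeff ω' η (τ * x)
  have hrw : (fun x => finiteRangeSum H.B (H.coeff ω') (fun y => φ (τ⁻¹ * y)) (Equiv.mulLeft τ x)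
      - z * φ (τ⁻¹ * Equiv.mulLeft τ x)) = fun x =>
      (finiteRangeSum H.B (H.coeff ω) φ x - z * φ x) +
      (finiteRangeSum H.B c' φ x - finiteRangeSum H.B (H.coeff ω) φ x) := by
    funext x
    simp [finiteRangeSum, c', mul_assoc]
  rw [hrw, add_mul, mul_assoc 2, mul_assoc 2]
  refine (sqENorm_add_le _ _).trans ?_
  gcongr
  refine sqENorm_finiteRangeSum_sub_le _ _ _ _ _ fun η hη x hx => ?_
  rw [enorm_sub_rev]
  exact hcoeff η hη x hx

end Coefficients

variable {Γ A : Type*} [Group Γ] [TopologicalSpace A] [Finite A] (H : FiniteRangeSchrodinger Γ A)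

theorem exists_nnnorm_t_le : ∃ C : ℝ≥0, ∀ η ∈ H.B, ∀ ω, ‖H.t η ω‖₊ ≤ C := by
  have h (η : H.B) : ∃ C : ℝ≥0, ∀ ω, ‖H.t η ω‖₊ ≤ C := by
    obtain ⟨C, hC⟩ := isCompact_univ.exists_bound_of_continuousOn
      (H.continuous_t η η.2).continuousOn
    exact ⟨C.toNNReal, fun ω => by
      rw [← NNReal.coe_le_coe]; exact (hC ω trivial).trans (Real.le_coe_toNNReal C)⟩
  choose C hC using h
  exact ⟨∑ η, C η, fun η hη ω => (hC ⟨η, hη⟩ ω).trans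
    (Finset.single_le_sum (f := C) (fun _ _ => zero_le) (Finset.mem_univ _))⟩

theorem exists_finset_forall_t [DiscreteTopology A] {ε : ℝ} (hε : 0 < ε) :
    ∃ K : Finset Γ, ∀ η ∈ H.B, ∀ ω ω' : Γ → A, (∀ k ∈ K, ω k = ω' k) →
      ‖H.t η ω - H.t η ω'‖ ≤ ε := by
  classical
  choose K hK using fun η : H.B => exists_finset_forall_norm_sub_le (H.continuous_t η η.2) hε
  exact ⟨Finset.univ.biUnion K, fun η hη ω ω' h => hK ⟨η, hη⟩ ω ω' fun k hk =>
    h k (Finset.mem_biUnion.2 ⟨_, Finset.mem_univ _, hk⟩)⟩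

theorem coe_op (ω : Γ → A) (ψ : EllTwo Γ) :
    (H.op ω ψ : Γ → ℂ) = finiteRangeSum H.B (H.coeff ω) ψ :=
  funext fun x => H.op_apply ω ψ x

theorem sqENorm_op_sub (ω : Γ → A) (z : ℂ) (ψ : EllTwo Γ) :
    sqENorm (fun x => finiteRangeSum H.B (H.coeff ω) ψ x - z * ψ x) =
      ENNReal.ofReal (‖H.op ω ψ - z • ψ‖ ^ 2) := by
  rw [← sqENorm_lp, ← coe_op]
  rfl

theorem exists_approx_eigenvector (ω : Γ → A) {z : ℝ} (hz : z ∈ spectrum ℝ (H.op ω)) {κ : ℝ≥0}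
    (hκ : 0 < κ) : ∃ ψ : EllTwo Γ, sqENorm ψ ≠ 0 ∧
      sqENorm (fun x => finiteRangeSum H.B (H.coeff ω) ψ x - z * ψ x) ≤ κ ^ 2 * sqENorm ψ := by
  have := mt ((H.isSelfAdjoint_op ω).forall_mem_spectrum_le_abs_sub_iff z κ.coe_nonneg).2 fun h =>
    absurd (h z hz) (by simpa using hκ)
  push Not at this
  obtain ⟨ψ, hψ⟩ := this
  refine ⟨ψ, ?_, ?_⟩
  · rw [sqENorm_lp, Ne, ENNReal.ofReal_eq_zero, not_le]
    have : 0 < ‖ψ‖ := by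
      by_contra h0
      have h0 : ‖ψ‖ = 0 := le_antisymm (not_lt.1 h0) (norm_nonneg _)
      rw [h0, mul_zero] at hψ
      exact absurd hψ (not_lt.2 (norm_nonneg _))
    positivity
  · rw [sqENorm_op_sub, sqENorm_lp, ← ENNReal.ofReal_coe_nnreal, ← ENNReal.ofReal_pow (by simp),
      ← ENNReal.ofReal_mul (by positivity), ← mul_pow]
    exact ENNReal.ofReal_le_ofReal (pow_le_pow_left₀ (norm_nonneg _) hψ.le 2)

/-- Finite support puts `φ` in `ℓ²`. Without spectrum within `δ` of `z`, the shifted operator would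
be bounded below by `δ`, which is impossible as `κ < δ`. -/
theorem exists_mem_spectrum_of_approx_eigenfunction (ω : Γ → A) (z : ℝ) {φ : Γ → ℂ}
    (hfin : φ.support.Finite) (h0 : sqENorm φ ≠ 0) {κ δ : ℝ≥0} (hκδ : κ < δ)
    (hφ : sqENorm (fun x => finiteRangeSum H.B (H.coeff ω) φ x - z * φ x) ≤
      κ ^ 2 * sqENorm φ) : ∃ w ∈ spectrum ℝ (H.op ω), dist z w ≤ δ := by
  have hmem : Memℓp φ 2 := (memℓp_zero hfin).of_exponent_ge zero_le
  obtain ⟨ψ, rfl⟩ : ∃ ψ : EllTwo Γ, (ψ : Γ → ℂ) = φ := ⟨⟨φ, hmem⟩, rfl⟩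
  by_contra! hcon
  have hb := ((H.isSelfAdjoint_op ω).forall_mem_spectrum_le_abs_sub_iff z δ.coe_nonneg).1
    (fun w hw => by simpa [Real.dist_eq, abs_sub_comm] using (hcon w hw).le) ψ
  rw [sqENorm_op_sub, sqENorm_lp, ← ENNReal.ofReal_coe_nnreal, ← ENNReal.ofReal_pow (by simp),
      ← ENNReal.ofReal_mul (by positivity), ← mul_pow,
      ENNReal.ofReal_le_ofReal_iff (by positivity),
      pow_le_pow_iff_left₀ (norm_nonneg _) (by positivity) two_ne_zero] at hφ
  rw [sqENorm_lp, Ne, ENNReal.ofReal_eq_zero, not_le] at h0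
  have hpos : 0 < ‖ψ‖ := by
    rcases (norm_nonneg ψ).eq_or_lt with h | h
    · simp [← h] at h0
    · exact h
  exact absurd (le_of_mul_le_mul_right (hb.trans hφ) hpos) (not_le.2 (by exact_mod_cast hκδ))

end FiniteRangeSchrodinger

/-! ### Spectra depend on dictionaries; convergence. -/

namespace SubstitutionMap.IsConvenientTestingDomain

variable {Γ A : Type*} [Group Γ] [MetricSpace Γ] [IsIsometricSMul Γ Γ]
  [Finite A] [TopologicalSpace A] [DiscreteTopology A] {S : SubstitutionMap Γ A} {T : Finset Γ}

/-- The spectrum of `H_ω` depends only on the `K`-patches of `ω`, up to `δ`. -/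
theorem exists_finset_forall_mem_spectrum (hT : S.IsConvenientTestingDomain T)
    (H : FiniteRangeSchrodinger Γ A) {δ : ℝ≥0} (hδ : 0 < δ) :
    ∃ K : Finset Γ, ∀ ω ω' : Γ → A, Patch.dictionary ω K ⊆ Patch.dictionary ω' K →
      ∀ z ∈ spectrum ℝ (H.op ω), ∃ w ∈ spectrum ℝ (H.op ω'), dist z w ≤ δ := by
  classical
  obtain ⟨C, hC⟩ := H.exists_nnnorm_t_le
  -- Localization error `b` and coefficient error `|B|ε ≤ δ/4` give `2b + 2(δ/4)² = (δ/2)²`. `Q` is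
  -- the coefficient of `κ²` in the localization lemma; `Q + 1` makes the inequality strict and
  -- avoids division by zero.
  set b : ℝ≥0 := δ ^ 2 / 16 with hb
  set Q : ℝ≥0 := 2 * T.card + 4 * T.card * H.B.card ^ 2 * C ^ 2 with hQ
  set κ : ℝ≥0 := NNReal.sqrt (b / (Q + 1)) with hκ_def
  have hbpos : 0 < b := by positivity
  have hκ : 0 < κ := NNReal.sqrt_pos.2 (by positivity)
  have hκb : 2 * T.card * κ ^ 2 + 4 * T.card * H.B.card ^ 2 * (C * κ) ^ 2 < b := by
    calc _ = Q * κ ^ 2 := by rw [hQ]; ring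
      _ < (Q + 1) * κ ^ 2 := by gcongr; exact lt_add_one Q
      _ = b := by rw [hκ_def, NNReal.sq_sqrt, mul_div_cancel₀ _ (by positivity)]
  set ε : ℝ≥0 := δ / (4 * (H.B.card + 1)) with hε_def
  have hε : 0 < ε := by positivity
  have hεb : 2 * b + 2 * (H.B.card ^ 2 * ε ^ 2) ≤ (δ / 2) ^ 2 := by
    have h1 : H.B.card * ε ≤ δ / 4 := by
      calc H.B.card * ε ≤ (H.B.card + 1) * ε := by gcongr; exact le_self_add
        _ = δ / 4 := by rw [hε_def]; field_simp
    calc 2 * b + 2 * (H.B.card ^ 2 * ε ^ 2) = 2 * b + 2 * (H.B.card * ε) ^ 2 := by ring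
      _ ≤ 2 * b + 2 * (δ / 4) ^ 2 := by gcongr
      _ = (δ / 2) ^ 2 := by rw [hb]; field_simp; norm_num
  obtain ⟨n, h, hh⟩ := hT.exists_isCutoffFamily H.B hκ
  obtain ⟨K₀, hK₀⟩ := H.exists_finset_forall_t (ε := ε) (by exact_mod_cast hε)
  have hVfin := S.finite_iteratedSupport n T.finite_toSet
  -- With `V = F(n, T)`: if `xη ∈ ρV` then `x ∈ ρVB⁻¹`, and up to `ε` the coefficient at `x` reads
  -- the configuration only on `xK₀`.
  refine ⟨hVfin.toFinset * H.B⁻¹ * K₀, fun ω ω' hω z hz => ?_⟩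
  obtain ⟨ψ, hψ0, hψ⟩ := H.exists_approx_eigenvector ω hz hκ
  obtain ⟨γ, hγ0, hγ⟩ := hh.exists_localized (H.coeff ω) C
    (fun η hη x => by exact_mod_cast hC η hη _) z hψ0 (by simp [sqENorm_lp]) (a := κ ^ 2) (b := b)
    hψ (by exact_mod_cast hκb)
  set φ : Γ → ℂ := fun x => h γ x * ψ x
  -- `F(n, γT) = ρF(n, T)`, so one window serves whichever cutoff `γ` was selected.
  set ρ : Γ := S.D^[n] γ
  have hφ (x : Γ) (hx : φ x ≠ 0) : ∃ v ∈ iteratedSupport S.F S.D n (T : Set Γ), ρ * v = x := by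
    have : x ∈ iteratedSupport S.F S.D n (γ • (T : Set Γ)) := by
      by_contra hn
      exact hx (by simp [φ, hh.eq_zero γ x hn])
    rwa [iteratedSupport_smul] at this
  -- At `ρ'` the configuration `ω'` shows the pattern of `ω` at `ρ`; left translation by `ρ'ρ⁻¹`
  -- moves `φ` there.
  obtain ⟨ρ', hρ'⟩ := (Patch.dictionary_subset_iff _ _ _).1 hω ρ
  have hcoeff : ∀ η ∈ H.B, ∀ x, φ (x * η) ≠ 0 →
      ‖H.coeff ω η x - H.coeff ω' η (ρ' * ρ⁻¹ * x)‖ₑ ≤ ε := by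
    intro η hη x hx
    obtain ⟨v, hv, hvx⟩ := hφ _ hx
    obtain rfl : x = ρ * (v * η⁻¹) := by rw [← mul_assoc, hvx, mul_inv_cancel_right]
    rw [enorm_le_coe, ← NNReal.coe_le_coe, coe_nnnorm]
    refine hK₀ η hη _ _ fun k hk => ?_
    have := hρ' (v * η⁻¹ * k) (Finset.mul_mem_mul (Finset.mul_mem_mul
      (hVfin.mem_toFinset.2 hv) (Finset.inv_mem_inv hη)) hk)
    simpa [shiftConfig, mul_assoc] using this.symm
  have hfin : (fun y => φ ((ρ' * ρ⁻¹)⁻¹ * y)).support.Finite := by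
    refine Set.Finite.subset (s := ρ' • iteratedSupport S.F S.D n (T : Set Γ)) hVfin.smul_set
      fun y hy => ?_
    obtain ⟨v, hv, hvy⟩ := hφ _ hy
    refine ⟨v, hv, ?_⟩
    simp only [mul_inv_rev, inv_inv, mul_assoc] at hvy
    simp [mul_left_cancel hvy]
  refine H.exists_mem_spectrum_of_approx_eigenfunction ω' z hfin ?_ (NNReal.half_lt_self hδ.ne')
    ((H.sqENorm_transplant_le φ hcoeff hγ).trans ?_)
  · rwa [show sqENorm (fun y => φ ((ρ' * ρ⁻¹)⁻¹ * y)) = sqENorm φ from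
      sqENorm_comp_equiv (Equiv.mulLeft _) φ]
  · gcongr
    exact_mod_cast hεb

/-- If the dictionaries of a sequence of configurations stabilize, then the spectra converge. -/
theorem exists_tendsto_spec (hT : S.IsConvenientTestingDomain T)
    (H : FiniteRangeSchrodinger Γ A) {ω : ℕ → Γ → A}
    (hω : ∀ K : Finset Γ, ∃ N, ∀ n, N ≤ n →
      Patch.dictionary (ω n) K = Patch.dictionary (ω N) K) :
    ∃ L : NonemptyCompacts ℝ, Tendsto (fun n => H.spec (ω n)) atTop (𝓝 L) := by
  refine cauchySeq_tendsto_of_complete (Metric.cauchySeq_iff'.2 fun ε hε => ?_)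
  obtain ⟨K, hK⟩ := hT.exists_finset_forall_mem_spectrum H
    (δ := (ε / 2).toNNReal) (by simpa using hε)
  rw [Real.coe_toNNReal _ (by positivity)] at hK
  obtain ⟨N, hN⟩ := hω K
  refine ⟨N, fun n hn => lt_of_le_of_lt ?_ (half_lt_self hε)⟩
  rw [NonemptyCompacts.dist_eq]
  exact hausdorffDist_le_of_mem_dist (by positivity) (hK _ _ (hN n hn).subset)
    (hK _ _ (hN n hn).superset)

end SubstitutionMap.IsConvenientTestingDomain

theorem corollary3p7 {Γ A : Type*} [Group Γ] [Countable Γ]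
    [MetricSpace Γ] [DiscreteTopology Γ] [ProperSpace Γ] [IsIsometricSMul Γ Γ]
    [Finite A] [TopologicalSpace A] [DiscreteTopology A]
    (S : SubstitutionMap Γ A) (T : Finset Γ) (hT : S.IsConvenientTestingDomain T)
    (ω₀ : Γ → A) :
    (∃ ℓ₀ : ℕ, S.IsEventualPeriod T ω₀ ℓ₀) ∧
      ∀ ℓ₀ : ℕ, S.IsEventualPeriod T ω₀ ℓ₀ →
        ∀ H : FiniteRangeSchrodinger Γ A,
          ∃ K : Fin ℓ₀ → NonemptyCompacts ℝ,
            ∀ j : Fin ℓ₀,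
              Tendsto (fun n : ℕ => H.spec (S.onConfig^[n * ℓ₀ + j] ω₀)) atTop (𝓝 (K j)) := by
  refine ⟨hT.exists_isEventualPeriod ω₀, fun ℓ₀ hℓ H => ?_⟩
  choose K hK using fun j : Fin ℓ₀ => hT.exists_tendsto_spec H
    (ω := fun n => S.onConfig^[n * ℓ₀ + j] ω₀) fun M => by
      obtain ⟨N, hN⟩ := hT.dictionary_eventually_periodic hℓ M
      refine ⟨N, fun n hn => ?_⟩
      induction n, hn using Nat.le_induction with
      | base => rfl
      | succ n hn ih =>
        -- `ℓ₀ ≥ 1` gives `n ≤ nℓ₀`, so the threshold for the full sequence also works along the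
        -- progression.
        have h1 : N ≤ n * ℓ₀ + j := hn.trans ((Nat.le_mul_of_pos_right n hℓ.1).trans le_self_add)
        rw [← ih, hN _ h1, Nat.add_right_comm, ← Nat.succ_mul]
  exact ⟨K, hK⟩
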